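/- Let $C(S,K)$, $S>0$, $K\ge 0$, be a Call pricing function: for every $S>0$ the map $K\mapsto C(S,K)$ is convex on $[0,\infty)$ and $(S-K)_+\le C(S,K)\le S$. For $v>0$ let $$\mathrm{BS}(S,K,v)=S\,\Phi(d_1(S,K,v))-K\,\Phi(d_2(S,K,v)),\qquad d_{1,2}(S,K,v)=-\frac{\log (K/S)}{v}\pm\frac v2,$$ with $\Phi$ the standard normal distribution function, and let $\mathrm{BS}(S,K,0)=(S-K)_+$. Fix $K>0$, assume that $S\mapsto C(S,K)$ is injective on $(0,\infty)$, with inverse $C^{-1}(\cdot,K)$, and fix $X$ in its range; write $S=C^{-1}(X,K)$. The price of the Call on Call with strike $M>0$ is $\hat C_K(X,M)=C(C^{-1}(X,K),K+M)$. Assume that $X>(S-K)_+$ and that $\hat C_K(X,M)<X$ for all $M>0$. Then for every $M>0$ there are unique $\hat v_K(X,M)\ge 0$ and $v(S,K+M)\ge0$ with $$\mathrm{BS}(X,M,\hat v_K(X,M))=\hat C_K(X,M),\qquad \mathrm{BS}(S,K+M,v(S,K+M))=C(S,K+M)$$ (the implied total volatilities of the Call on Call and of the underlying Call), and: 1. (Small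 strikes.) With $\hat d_2(X,M)=d_2(X,M,\hat v_K(X,M))$, the limit $\hat d_2(X,0):=\lim_{M\to0^+}\hat d_2(X,M)$ exists and is finite, and, as $M\to0^+$, $$\hat v_K(X,M)\sim\sqrt{-2\log\tfrac MX}-\hat d_2(X,0),\quad\text{and even}\quad \hat v_K(X,M)=\sqrt{-2\log\tfrac MX}-\hat d_2(X,0)+o(1).$$ 2. (Large strikes.) $\hat v_K(X,M)\sim v(C^{-1}(X,K),K+M)$ as $M\to\infty$. Moreover, for every $\ell\in\mathbb R\cup\{+\infty\}$, $\hat v_K(X,M)\to\ell$ as $M\to\infty$ if and only if $v(C^{-1}(X,K),K+M)\to\ell$. Here $f\sim g$ means $f-g=o(g)$ (that is, $f/g\to1$ where $g\neq0$). -/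

import Mathlib

open Set Filter Topology Asymptotics

noncomputable section

/-- A pricing function `C S K` of Calls, with underlier `S > 0` and strike `K ≥ 0`: Call prices are
convex in the strike and satisfy `(S - K)₊ ≤ C S K ≤ S`. (These two properties imply that prices
are non-increasing in the strike.) -/
structure IsCallPricingFunction (C : ℝ → ℝ → ℝ) : Prop where
  convex : ∀ S, 0 < S → ConvexOn ℝ (Ici 0) (C S)
  lower : ∀ S K, 0 < S → 0 ≤ K → max (S - K) 0 ≤ C S K
  upper : ∀ S K, 0 < S → 0 ≤ K → C S K ≤ S

/-- The inverse `C⁻¹(X, K)` in the underlier: the `S > 0` with `C S K = X`. -/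
def callInv (C : ℝ → ℝ → ℝ) (X K : ℝ) : ℝ :=
  Function.invFunOn (fun S => C S K) (Ioi 0) X

/-- The Call on Call price `Ĉ_K(X, M) = C(C⁻¹(X, K), K + M)`. -/
def callOnCall (C : ℝ → ℝ → ℝ) (K X M : ℝ) : ℝ :=
  C (callInv C X K) (K + M)

/-- The standard normal cumulative distribution function `Φ`. -/
def stdNormalCDF (x : ℝ) : ℝ :=
  ProbabilityTheory.cdf (ProbabilityTheory.gaussianReal 0 1) x

def d₁ (S K v : ℝ) : ℝ := -Real.log (K / S) / v + v / 2

def d₂ (S K v : ℝ) : ℝ := -Real.log (K / S) / v - v / 2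

/-- The Black-Scholes price with total volatility `v ≥ 0`; for `v = 0` it is the intrinsic value,
which is the limit as `v` decreases to `0`. -/
def blackScholes (S K v : ℝ) : ℝ :=
  if v = 0 then max (S - K) 0
  else S * stdNormalCDF (d₁ S K v) - K * stdNormalCDF (d₂ S K v)

/-- The implied total volatility: the `v ≥ 0` with `blackScholes S K v = p`. -/
def impliedTotalVol (S K p : ℝ) : ℝ :=
  Function.invFunOn (blackScholes S K) (Ici 0) p

/-- The implied total volatility `v(S, L)` of the pricing function `C`. -/
def underlyingVol (C : ℝ → ℝ → ℝ) (S L : ℝ) : ℝ :=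
  impliedTotalVol S L (C S L)

/-- The implied total volatility `v̂_K(X, M)` of the Call on Call. -/
def callOnCallVol (C : ℝ → ℝ → ℝ) (K X M : ℝ) : ℝ :=
  impliedTotalVol X M (callOnCall C K X M)

/-- `d̂₂(X, M) = d₂(X, M, v̂_K(X, M))`. -/
def callOnCallD₂ (C : ℝ → ℝ → ℝ) (K X M : ℝ) : ℝ :=
  d₂ X M (callOnCallVol C K X M)

end

/-! Write `S` for the inverse `callInv C X K`, so that `C S K = X`, and `p M = C S (K + M)`.

Small strikes. By convexity `p` has a right slope `-q` at `0`. Strict decrease from `X` gives `q >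
0`; the chord over `[0, K]` and the time value `X > S - K` give `q ≤ (S - X) / K < 1`. The
Black-Scholes formula reads `(X - p) / M = (X / M) (1 - Φ(d₁)) + Φ(d₂)`. Since `X φ(d₁) = M φ(d₂)`,
Mills' inequality bounds the first term by `φ(d₂) / d₁`, which vanishes, so `d₂` tends to the
`q`-quantile `δ`. Solving `d₁² - d₂² = -2 log (M / X)` for `v = d₁ - d₂` gives the expansion
(`tendsto_d₂_of_tendsto_slope`, `tendsto_vol_sub_of_tendsto_d₂`).

Large strikes. The same price `p M` is inverted for `(X, M)`, giving `u`, and for `(S, K + M)`,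
giving `w`. Since `X < S`, the second pair has the larger underlier and eventually the smaller ratio
of strike to underlier, so `w ≤ u`. Conversely `u ≤ r w` eventually, for each `r > 1`: scaling the
volatility raises `d₁` enough to absorb both the factor `S / X` and the shift of log-strike
(`eventually_exp_mul_normalizedBS_le`, `isEquivalent_vol_atTop`). -/

/-! ### The standard normal law and Mills' inequality. -/

/-- The standard normal density. -/
noncomputable def stdNormalPDF (x : ℝ) : ℝ := (√(2 * Real.pi))⁻¹ * Real.exp (-x ^ 2 / 2)

lemma stdNormalPDF_pos (x : ℝ) : 0 < stdNormalPDF x := by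
  unfold stdNormalPDF; positivity

lemma stdNormalPDF_neg (x : ℝ) : stdNormalPDF (-x) = stdNormalPDF x := by
  simp [stdNormalPDF]

lemma stdNormalPDF_le_one (x : ℝ) : stdNormalPDF x ≤ 1 := by
  have h1 : (√(2 * Real.pi))⁻¹ ≤ 1 := by
    apply inv_le_one_of_one_le₀
    rw [Real.one_le_sqrt]
    nlinarith [Real.pi_gt_three]
  have h2 : Real.exp (-x ^ 2 / 2) ≤ 1 := by
    rw [Real.exp_le_one_iff]; nlinarith [sq_nonneg x]
  exact mul_le_one₀ h1 (Real.exp_pos _).le h2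

lemma hasDerivAt_stdNormalPDF (x : ℝ) : HasDerivAt stdNormalPDF (-x * stdNormalPDF x) x := by
  have h : HasDerivAt (fun y : ℝ => -y ^ 2 / 2) (-x) x := by
    refine ((hasDerivAt_pow 2 x).neg.div_const 2).congr_deriv ?_
    simp only [Nat.cast_ofNat, Nat.add_one_sub_one, pow_one]
    ring
  refine (h.exp.const_mul (√(2 * Real.pi))⁻¹).congr_deriv ?_
  unfold stdNormalPDF; ring

lemma continuous_stdNormalPDF : Continuous stdNormalPDF := by
  unfold stdNormalPDF; fun_prop

lemma gaussianPDFReal_eq_stdNormalPDF :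
    ProbabilityTheory.gaussianPDFReal 0 1 = stdNormalPDF := by
  ext x; simp [ProbabilityTheory.gaussianPDFReal, stdNormalPDF]

lemma integrable_stdNormalPDF : MeasureTheory.Integrable stdNormalPDF := by
  rw [← gaussianPDFReal_eq_stdNormalPDF]
  exact ProbabilityTheory.integrable_gaussianPDFReal 0 1

lemma stdNormalCDF_eq_integral (x : ℝ) : stdNormalCDF x = ∫ t in Iic x, stdNormalPDF t := by
  rw [stdNormalCDF, ProbabilityTheory.cdf_eq_real, MeasureTheory.Measure.real,
    ProbabilityTheory.gaussianReal_apply_eq_integral _ (one_ne_zero), ENNReal.toReal_ofReal,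
    gaussianPDFReal_eq_stdNormalPDF]
  exact MeasureTheory.integral_nonneg fun t =>
    ProbabilityTheory.gaussianPDFReal_nonneg 0 1 t

lemma hasDerivAt_stdNormalCDF (x : ℝ) : HasDerivAt stdNormalCDF (stdNormalPDF x) x := by
  have h : stdNormalCDF = fun x => stdNormalCDF 0 + ∫ t in (0 : ℝ)..x, stdNormalPDF t := by
    ext y
    rw [← intervalIntegral.integral_Iic_sub_Iic integrable_stdNormalPDF.integrableOn
      integrable_stdNormalPDF.integrableOn, stdNormalCDF_eq_integral, stdNormalCDF_eq_integral]
    ring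
  rw [h]
  exact (intervalIntegral.integral_hasDerivAt_right
    (continuous_stdNormalPDF.intervalIntegrable _ _)
    (continuous_stdNormalPDF.stronglyMeasurableAtFilter _ _)
    continuous_stdNormalPDF.continuousAt).const_add _

lemma continuous_stdNormalCDF : Continuous stdNormalCDF :=
  continuous_iff_continuousAt.2 fun x => (hasDerivAt_stdNormalCDF x).continuousAt

lemma strictMono_stdNormalCDF : StrictMono stdNormalCDF :=
  strictMono_of_hasDerivAt_pos hasDerivAt_stdNormalCDF stdNormalPDF_pos

lemma tendsto_stdNormalCDF_atBot : Tendsto stdNormalCDF atBot (𝓝 0) :=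
  ProbabilityTheory.tendsto_cdf_atBot _

lemma tendsto_stdNormalCDF_atTop : Tendsto stdNormalCDF atTop (𝓝 1) :=
  ProbabilityTheory.tendsto_cdf_atTop _

lemma stdNormalCDF_nonneg (x : ℝ) : 0 ≤ stdNormalCDF x := ProbabilityTheory.cdf_nonneg _ x

lemma stdNormalCDF_le_one (x : ℝ) : stdNormalCDF x ≤ 1 := ProbabilityTheory.cdf_le_one _ x

lemma stdNormalCDF_add_neg (x : ℝ) : stdNormalCDF x + stdNormalCDF (-x) = 1 := by
  have hd : ∀ y, HasDerivAt (fun y => stdNormalCDF y + stdNormalCDF (-y)) 0 y := by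
    intro y
    refine ((hasDerivAt_stdNormalCDF y).add
      ((hasDerivAt_stdNormalCDF (-y)).comp y (hasDerivAt_neg y))).congr_deriv ?_
    rw [stdNormalPDF_neg]; ring
  have hc : ∀ y, stdNormalCDF x + stdNormalCDF (-x) = stdNormalCDF y + stdNormalCDF (-y) :=
    fun y => is_const_of_deriv_eq_zero (fun z => (hd z).differentiableAt)
      (fun z => (hd z).deriv) x y
  have hl := tendsto_stdNormalCDF_atTop.add
    (tendsto_stdNormalCDF_atBot.comp tendsto_neg_atTop_atBot)
  rw [add_zero] at hl
  refine tendsto_nhds_unique (tendsto_const_nhds (f := (atTop : Filter ℝ))) (hl.congr fun y => ?_)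
  exact (hc y).symm

/-- A function with nonnegative derivative on `(-∞, b]` that vanishes at `-∞` is nonnegative. -/
lemma nonneg_of_hasDerivAt_of_tendsto_atBot {f f' : ℝ → ℝ} {b : ℝ}
    (hf : ∀ x ≤ b, HasDerivAt f (f' x) x) (hf' : ∀ x ≤ b, 0 ≤ f' x)
    (hlim : Tendsto f atBot (𝓝 0)) : 0 ≤ f b := by
  have hm : MonotoneOn f (Iic b) := by
    refine monotoneOn_of_deriv_nonneg (convex_Iic b)
      (fun x hx => (hf x hx).continuousAt.continuousWithinAt)
      (fun x hx => (hf x (interior_subset (s := Iic b) hx)).differentiableAt.differentiableWithinAt) ?_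
    intro x hx
    rw [(hf x (interior_subset (s := Iic b) hx)).deriv]
    exact hf' x (interior_subset (s := Iic b) hx)
  refine le_of_tendsto hlim ?_
  filter_upwards [eventually_le_atBot b] with x hx
  exact hm hx (self_mem_Iic) hx

lemma tendsto_stdNormalPDF_atBot : Tendsto stdNormalPDF atBot (𝓝 0) := by
  have h : Tendsto (fun x : ℝ => -x ^ 2 / 2) atBot atBot := by
    have h2 : Tendsto (fun x : ℝ => x ^ 2) atBot atTop := by
      simpa [Function.comp_def] using
        (tendsto_pow_atTop (α := ℝ) two_ne_zero).comp tendsto_neg_atBot_atTop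
    exact (tendsto_neg_atTop_atBot.comp h2).atBot_div_const two_pos
  have := (Real.tendsto_exp_atBot.comp h).const_mul (√(2 * Real.pi))⁻¹
  rwa [mul_zero] at this

/-- Mills' inequality for the lower tail. -/
lemma neg_mul_stdNormalCDF_le {x : ℝ} (hx : x < 0) : -x * stdNormalCDF x ≤ stdNormalPDF x := by
  -- The gap `φ(y) / (-y) - Φ(y)` has derivative `φ(y) / y²` and vanishes at `-∞`.
  have h := nonneg_of_hasDerivAt_of_tendsto_atBot (b := x)
    (f := fun y => stdNormalPDF y * (-y)⁻¹ - stdNormalCDF y)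
    (f' := fun y => stdNormalPDF y / y ^ 2) ?_ ?_ ?_
  · have hx' : 0 < -x := by linarith
    rw [sub_nonneg, ← div_eq_mul_inv, le_div_iff₀ hx'] at h
    linarith
  · intro y (hy : y ≤ x)
    have hy0 : y ≠ 0 := by linarith
    have hi : HasDerivAt (fun y : ℝ => (-y)⁻¹) (1 / y ^ 2) y :=
      ((hasDerivAt_neg y).fun_inv (neg_ne_zero.2 hy0)).congr_deriv (by simp)
    refine (((hasDerivAt_stdNormalPDF y).mul hi).sub
      (hasDerivAt_stdNormalCDF y)).congr_deriv ?_
    field_simp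
    ring
  · intro y _
    have := (stdNormalPDF_pos y).le
    positivity
  · have h1 : Tendsto (fun y : ℝ => (-y)⁻¹) atBot (𝓝 0) :=
      tendsto_inv_atTop_zero.comp tendsto_neg_atBot_atTop
    simpa using (tendsto_stdNormalPDF_atBot.mul h1).sub tendsto_stdNormalCDF_atBot

/-- Mills' inequality for the upper tail. -/
lemma mul_one_sub_stdNormalCDF_le {x : ℝ} (hx : 0 < x) :
    x * (1 - stdNormalCDF x) ≤ stdNormalPDF x := by
  have h := neg_mul_stdNormalCDF_le (neg_lt_zero.2 hx)
  rw [neg_neg, stdNormalPDF_neg] at h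
  rwa [← stdNormalCDF_add_neg x, add_sub_cancel_left]

/-! ### The Black-Scholes price in the coordinates `(v, d₁)`. -/

/-- The Black-Scholes price per unit of underlier, as a function of `v` and `x = d₁`. -/
noncomputable def normalizedBS (v x : ℝ) : ℝ :=
  stdNormalCDF x - Real.exp (v ^ 2 / 2 - x * v) * stdNormalCDF (x - v)

lemma exp_mul_stdNormalPDF (v x : ℝ) :
    Real.exp (v ^ 2 / 2 - x * v) * stdNormalPDF (x - v) = stdNormalPDF x := by
  unfold stdNormalPDF
  rw [mul_left_comm, ← Real.exp_add]
  congr 2; ring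

lemma hasDerivAt_normalizedBS_right (v x : ℝ) :
    HasDerivAt (normalizedBS v)
      (v * (Real.exp (v ^ 2 / 2 - x * v) * stdNormalCDF (x - v))) x := by
  have he : HasDerivAt (fun y : ℝ => v ^ 2 / 2 - y * v) (-v) x := by
    simpa using ((hasDerivAt_id x).mul_const v).const_sub (v ^ 2 / 2)
  have hc : HasDerivAt (fun y : ℝ => stdNormalCDF (y - v)) (stdNormalPDF (x - v)) x := by
    simpa using (hasDerivAt_stdNormalCDF (x - v)).comp_sub_const x v
  refine ((hasDerivAt_stdNormalCDF x).sub (he.exp.mul hc)).congr_deriv ?_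
  rw [exp_mul_stdNormalPDF]; ring

lemma hasDerivAt_normalizedBS_left (v x : ℝ) :
    HasDerivAt (fun w => normalizedBS w x)
      (Real.exp (v ^ 2 / 2 - x * v) * (stdNormalPDF (x - v) + (x - v) * stdNormalCDF (x - v)))
      v := by
  have he : HasDerivAt (fun w : ℝ => w ^ 2 / 2 - x * w) (v - x) v := by
    refine (((hasDerivAt_pow 2 v).div_const 2).sub ((hasDerivAt_id v).const_mul x)).congr_deriv ?_
    simp
  have hc : HasDerivAt (fun w : ℝ => stdNormalCDF (x - w)) (-stdNormalPDF (x - v)) v := by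
    simpa using (hasDerivAt_stdNormalCDF (x - v)).comp_const_sub x v
  refine ((he.exp.mul hc).const_sub (stdNormalCDF x)).congr_deriv ?_
  ring

lemma normalizedBS_mono_right {v : ℝ} (hv : 0 ≤ v) : Monotone (normalizedBS v) :=
  monotone_of_hasDerivAt_nonneg (hasDerivAt_normalizedBS_right v) fun _ =>
    mul_nonneg hv (mul_nonneg (Real.exp_pos _).le (stdNormalCDF_nonneg _))

/-- Here `d₁` is frozen, so the strike moves with `v`; the sign of the derivative is that of `φ(y) +
y Φ(y)` at `y = x - v`, nonnegative by Mills. -/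
lemma normalizedBS_mono_left (x : ℝ) : Monotone (fun v => normalizedBS v x) := by
  refine monotone_of_hasDerivAt_nonneg (fun v => hasDerivAt_normalizedBS_left v x) fun v =>
    mul_nonneg (Real.exp_pos _).le ?_
  rcases lt_or_ge (x - v) 0 with h | h
  · linarith [neg_mul_stdNormalCDF_le h]
  · have := (stdNormalPDF_pos (x - v)).le
    have := stdNormalCDF_nonneg (x - v)
    positivity

lemma exp_mul_stdNormalCDF_le {v x : ℝ} (h : x < v) :
    Real.exp (v ^ 2 / 2 - x * v) * stdNormalCDF (x - v) ≤ stdNormalPDF x / (v - x) := by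
  rw [le_div_iff₀ (sub_pos.2 h), ← exp_mul_stdNormalPDF v x, mul_assoc]
  refine mul_le_mul_of_nonneg_left ?_ (Real.exp_pos _).le
  have := neg_mul_stdNormalCDF_le (sub_neg.2 h)
  linarith

lemma tendsto_normalizedBS_atBot (v : ℝ) : Tendsto (normalizedBS v) atBot (𝓝 0) := by
  have h2 : Tendsto (fun x => stdNormalPDF x / (v - x)) atBot (𝓝 0) :=
    tendsto_stdNormalPDF_atBot.div_atTop
      (tendsto_atTop_add_const_left _ v tendsto_neg_atBot_atTop)
  have h1 : Tendsto (fun x => Real.exp (v ^ 2 / 2 - x * v) * stdNormalCDF (x - v)) atBot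
      (𝓝 0) := by
    refine tendsto_of_tendsto_of_tendsto_of_le_of_le' tendsto_const_nhds h2
      (Eventually.of_forall fun x => mul_nonneg (Real.exp_pos _).le (stdNormalCDF_nonneg _)) ?_
    filter_upwards [eventually_lt_atBot v] with x hx using exp_mul_stdNormalCDF_le hx
  have h := tendsto_stdNormalCDF_atBot.sub h1
  rwa [sub_zero] at h

lemma normalizedBS_nonneg {v : ℝ} (hv : 0 ≤ v) (x : ℝ) : 0 ≤ normalizedBS v x :=
  nonneg_of_hasDerivAt_of_tendsto_atBot (fun y _ => hasDerivAt_normalizedBS_right v y)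
    (fun _ _ => mul_nonneg hv (mul_nonneg (Real.exp_pos _).le (stdNormalCDF_nonneg _)))
    (tendsto_normalizedBS_atBot v)

/-- The density ratio `φ(z + 1) / φ(z) = exp (-z - 1/2)` is at least `exp c` for all `z ≤ y`;
integrate from `-∞`. -/
lemma exp_mul_stdNormalCDF_le_stdNormalCDF_add_one {c y : ℝ} (h : y ≤ -c - 1 / 2) :
    Real.exp c * stdNormalCDF y ≤ stdNormalCDF (y + 1) := by
  rw [← sub_nonneg]
  refine nonneg_of_hasDerivAt_of_tendsto_atBot (b := y)
    (f := fun y => stdNormalCDF (y + 1) - Real.exp c * stdNormalCDF y)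
    (fun z _ => ((hasDerivAt_stdNormalCDF (z + 1)).comp_add_const z 1).sub
      ((hasDerivAt_stdNormalCDF z).const_mul _)) ?_ ?_
  · intro z hz
    rw [sub_nonneg]
    unfold stdNormalPDF
    rw [mul_left_comm, ← Real.exp_add]
    gcongr
    nlinarith
  · have := (tendsto_stdNormalCDF_atBot.comp (tendsto_atBot_add_const_right atBot 1 tendsto_id)).sub
      (tendsto_stdNormalCDF_atBot.const_mul (Real.exp c))
    simpa using this

/-- Far out of the money, a unit increase of `d₁` multiplies the price by at least `exp a`. -/
lemma exp_mul_normalizedBS_le {a v x : ℝ} (hv : 0 ≤ v) (hx : x ≤ -a - 1 / 2) :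
    Real.exp a * normalizedBS v x ≤ normalizedBS v (x + 1) := by
  rw [← sub_nonneg]
  refine nonneg_of_hasDerivAt_of_tendsto_atBot (b := x)
    (f := fun y => normalizedBS v (y + 1) - Real.exp a * normalizedBS v y)
    (fun z _ => ((hasDerivAt_normalizedBS_right v (z + 1)).comp_add_const z 1).sub
      ((hasDerivAt_normalizedBS_right v z).const_mul _)) ?_ ?_
  · intro z hz
    -- The unit shift costs a factor `exp (-v)` in the exponential, hence `c = a + v`; evaluating at
    -- `z - v` cancels this `v`, so the threshold on `z` does not depend on `v`.
    have h := exp_mul_stdNormalCDF_le_stdNormalCDF_add_one (c := a + v) (y := z - v) (by linarith)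
    have h' := mul_le_mul_of_nonneg_left h
      (mul_nonneg hv (Real.exp_pos (v ^ 2 / 2 - (z + 1) * v)).le)
    have e : Real.exp (v ^ 2 / 2 - (z + 1) * v) * Real.exp (a + v)
        = Real.exp a * Real.exp (v ^ 2 / 2 - z * v) := by
      rw [← Real.exp_add, ← Real.exp_add]; congr 1; ring
    rw [show z + 1 - v = z - v + 1 by ring]
    rw [sub_nonneg]
    calc _ = v * (Real.exp a * Real.exp (v ^ 2 / 2 - z * v)) * stdNormalCDF (z - v) := by ring
      _ = _ := by rw [← e]; ring
      _ ≤ _ := h'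
      _ = _ := by ring
  · have := ((tendsto_normalizedBS_atBot v).comp
      (tendsto_atBot_add_const_right atBot 1 tendsto_id)).sub
      ((tendsto_normalizedBS_atBot v).const_mul (Real.exp a))
    simpa using this

lemma exists_le_normalizedBS {θ : ℝ} (hθ : θ < 1) :
    ∃ y V : ℝ, 0 < V ∧ ∀ v ≥ V, θ ≤ normalizedBS v y := by
  -- Half of the gap `1 - θ` is spent on `Φ(y)`, half on the strike term, which is at most `1 / (v -
  -- y)`.
  obtain ⟨y, hy⟩ := (tendsto_stdNormalCDF_atTop.eventually
    (lt_mem_nhds (show (θ + 1) / 2 < 1 by linarith))).exists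
  have hp : 0 < 2 / (1 - θ) := div_pos two_pos (by linarith)
  refine ⟨y, max 1 (y + 2 / (1 - θ)), by positivity, fun v hv => ?_⟩
  have hv' : 2 / (1 - θ) ≤ v - y := by linarith [le_max_right 1 (y + 2 / (1 - θ))]
  have h1 := exp_mul_stdNormalCDF_le (v := v) (x := y) (by linarith)
  have h2 : stdNormalPDF y / (v - y) ≤ (1 - θ) / 2 := by
    rw [div_le_iff₀ (by linarith)]
    rw [div_le_iff₀ (by linarith)] at hv'
    nlinarith [stdNormalPDF_le_one y]
  unfold normalizedBS
  linarith

/-- For large log-strikes `k`, scaling the volatility by `r > 1` outweighs both a shift of the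
log-strike by `a` and a factor `exp a` in the price. -/
lemma eventually_exp_mul_normalizedBS_le {a r θ : ℝ} (ha : 0 ≤ a) (hr : 1 < r) (hθ : θ < 1) :
    ∀ᶠ k : ℝ in atTop, ∀ v > 0, Real.exp a * normalizedBS v (-k / v + v / 2) ≤ θ →
      Real.exp a * normalizedBS v (-k / v + v / 2) ≤
        normalizedBS (r * v) (-(k + a) / (r * v) + r * v / 2) := by
  obtain ⟨y, V, hV, hyV⟩ := exists_le_normalizedBS hθ
  -- `T` is the rise of `d₁` to be guaranteed: at least `1` to gain the factor `exp a` far out of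
  -- the money, and large enough to pass `y` from any `x > -a - 1/2`.
  set T := max 1 (y + (a + 1 / 2)) with hT
  have hr0 : 0 < r := by linarith
  -- This threshold makes the rise uniform in `v`, through `T v ≤ T² / (2 (r - 1)) + (r - 1) v² /
  -- 2`.
  have hev : ∀ᶠ k : ℝ in atTop, T ^ 2 / (2 * (r - 1)) * r + a ≤ (r - 1) * k :=
    (tendsto_id.const_mul_atTop (sub_pos.2 hr)).eventually_ge_atTop _
  filter_upwards [hev, eventually_gt_atTop (V ^ 2 / 2 + (a + 1 / 2) * V)] with k hk hkV v hv hle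
  set x := -k / v + v / 2 with hx
  have hshift : x + T ≤ -(k + a) / (r * v) + r * v / 2 := by
    have h1 : -(k + a) / (r * v) + r * v / 2 - x - T
        = (((r - 1) * k - a) / r + (r - 1) * v ^ 2 / 2 - T * v) / v := by
      rw [hx]; field_simp; ring
    have h2 : T ^ 2 / (2 * (r - 1)) ≤ ((r - 1) * k - a) / r := by
      rw [le_div_iff₀ hr0]; linarith
    have h3 : 0 ≤ T ^ 2 / (2 * (r - 1)) + (r - 1) * v ^ 2 / 2 - T * v := by
      have hr1 : 0 < r - 1 := sub_pos.2 hr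
      have : T ^ 2 / (2 * (r - 1)) + (r - 1) * v ^ 2 / 2 - T * v
          = (T - (r - 1) * v) ^ 2 / (2 * (r - 1)) := by field_simp; ring
      rw [this]; positivity
    have : 0 ≤ -(k + a) / (r * v) + r * v / 2 - x - T := by
      rw [h1]; exact div_nonneg (by linarith) hv.le
    linarith
  have hmono : normalizedBS v (x + T) ≤ normalizedBS (r * v) (-(k + a) / (r * v) + r * v / 2) :=
    (normalizedBS_mono_right hv.le hshift).trans
      (normalizedBS_mono_left _ (le_mul_of_one_le_left hv.le hr.le))
  rcases le_or_gt x (-a - 1 / 2) with hxa | hxa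
  · exact (exp_mul_normalizedBS_le hv.le hxa).trans
      ((normalizedBS_mono_right hv.le (by linarith [le_max_left 1 (y + (a + 1 / 2))])).trans hmono)
  -- With `k` large, `d₁` is above `-a - 1/2` only if `v` is large, and then the price at `y`
  -- already exceeds `θ`.
  · have hvV : V ≤ v := by
      by_contra! hlt
      have h1 : (-a - 1 / 2) * v < -k + v ^ 2 / 2 := by
        have := mul_lt_mul_of_pos_right hxa hv
        rw [hx] at this
        calc _ < _ := this
          _ = _ := by field_simp
      nlinarith
    exact hle.trans ((hyV v hvV).trans ((normalizedBS_mono_right hv.le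
      (by linarith [le_max_right 1 (y + (a + 1 / 2))])).trans hmono))

/-! ### The Black-Scholes price as a function of volatility, and its inversion. -/

lemma d₂_eq_d₁_sub (S K v : ℝ) : d₂ S K v = d₁ S K v - v := by
  unfold d₁ d₂; ring

lemma exp_sub_d₁_mul {S K v : ℝ} (hS : 0 < S) (hK : 0 < K) (hv : v ≠ 0) :
    Real.exp (v ^ 2 / 2 - d₁ S K v * v) = K / S := by
  have : v ^ 2 / 2 - d₁ S K v * v = Real.log (K / S) := by
    unfold d₁; field_simp; ring
  rw [this, Real.exp_log (div_pos hK hS)]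

lemma mul_stdNormalPDF_d₁ {S K v : ℝ} (hS : 0 < S) (hK : 0 < K) (hv : v ≠ 0) :
    S * stdNormalPDF (d₁ S K v) = K * stdNormalPDF (d₂ S K v) := by
  rw [d₂_eq_d₁_sub, ← exp_mul_stdNormalPDF v (d₁ S K v), exp_sub_d₁_mul hS hK hv]
  field_simp

lemma blackScholes_zero (S K : ℝ) : blackScholes S K 0 = max (S - K) 0 := if_pos rfl

lemma blackScholes_of_ne {S K v : ℝ} (hv : v ≠ 0) : blackScholes S K v =
    S * stdNormalCDF (d₁ S K v) - K * stdNormalCDF (d₂ S K v) := if_neg hv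

lemma blackScholes_eq_mul_normalizedBS {S K v : ℝ} (hS : 0 < S) (hK : 0 < K) (hv : v ≠ 0) :
    blackScholes S K v = S * normalizedBS v (d₁ S K v) := by
  rw [blackScholes_of_ne hv, normalizedBS, exp_sub_d₁_mul hS hK hv, d₂_eq_d₁_sub]
  field_simp

lemma hasDerivAt_blackScholes {S K v : ℝ} (hS : 0 < S) (hK : 0 < K) (hv : v ≠ 0) :
    HasDerivAt (blackScholes S K) (S * stdNormalPDF (d₁ S K v)) v := by
  have hi : HasDerivAt (fun w : ℝ => -Real.log (K / S) / w) (Real.log (K / S) / v ^ 2) v := by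
    refine ((hasDerivAt_const v (-Real.log (K / S))).fun_div (hasDerivAt_id' v) hv).congr_deriv ?_
    ring
  have h1 : HasDerivAt (d₁ S K) (Real.log (K / S) / v ^ 2 + 1 / 2) v :=
    hi.add ((hasDerivAt_id' v).div_const 2)
  have h2 : HasDerivAt (d₂ S K) (Real.log (K / S) / v ^ 2 - 1 / 2) v :=
    hi.sub ((hasDerivAt_id' v).div_const 2)
  have h := (((hasDerivAt_stdNormalCDF _).comp v h1).const_mul S).sub
    (((hasDerivAt_stdNormalCDF _).comp v h2).const_mul K)
  refine (h.congr_of_eventuallyEq ?_).congr_deriv ?_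
  · filter_upwards [isOpen_ne.mem_nhds hv] with w hw using blackScholes_of_ne hw
  · linear_combination (Real.log (K / S) / v ^ 2 - 1 / 2) * mul_stdNormalPDF_d₁ hS hK hv

lemma tendsto_half_nhdsGT_zero : Tendsto (fun v : ℝ => v / 2) (𝓝[>] 0) (𝓝 0) := by
  have h : Tendsto (fun v : ℝ => v / 2) (𝓝 0) (𝓝 (0 / 2)) := (continuous_id.div_const 2).tendsto 0
  rw [zero_div] at h
  exact h.mono_left nhdsWithin_le_nhds

lemma tendsto_div_nhdsGT_zero_atBot {c : ℝ} (hc : c < 0) :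
    Tendsto (fun v : ℝ => c / v) (𝓝[>] 0) atBot :=
  tendsto_inv_nhdsGT_zero.const_mul_atTop_of_neg hc

lemma tendsto_div_nhdsGT_zero_atTop {c : ℝ} (hc : 0 < c) :
    Tendsto (fun v : ℝ => c / v) (𝓝[>] 0) atTop :=
  tendsto_inv_nhdsGT_zero.const_mul_atTop hc

lemma tendsto_blackScholes_nhdsGT_zero {S K : ℝ} (hS : 0 < S) (hK : 0 < K) :
    Tendsto (blackScholes S K) (𝓝[>] 0) (𝓝 (max (S - K) 0)) := by
  have hlim : ∀ {l : ℝ}, Tendsto (fun v => stdNormalCDF (d₁ S K v)) (𝓝[>] 0) (𝓝 l) →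
      Tendsto (fun v => stdNormalCDF (d₂ S K v)) (𝓝[>] 0) (𝓝 l) →
      Tendsto (blackScholes S K) (𝓝[>] 0) (𝓝 (S * l - K * l)) := by
    intro l h1 h2
    refine ((h1.const_mul S).sub (h2.const_mul K)).congr' ?_
    filter_upwards [self_mem_nhdsWithin] with v hv using (blackScholes_of_ne (ne_of_gt hv)).symm
  have hh := tendsto_half_nhdsGT_zero
  have hn : Tendsto (fun v : ℝ => -(v / 2)) (𝓝[>] 0) (𝓝 0) := by simpa using hh.neg
  -- As `v` decreases to `0`, both `d₁` and `d₂` tend to `-∞`, `0` or `+∞` according to moneyness,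
  -- so both values of `Φ` share one limit.
  rcases lt_trichotomy S K with h | h | h
  · have hL : -Real.log (K / S) < 0 := neg_lt_zero.2 (Real.log_pos ((one_lt_div hS).2 h))
    have hb := tendsto_div_nhdsGT_zero_atBot hL
    have := hlim (tendsto_stdNormalCDF_atBot.comp (hb.atBot_add hh))
      (tendsto_stdNormalCDF_atBot.comp (hb.atBot_add hn))
    rw [max_eq_right (by linarith)]
    simpa using this
  · have hL : Real.log (K / S) = 0 := by rw [h, div_self hK.ne', Real.log_one]
    have c0 := continuous_stdNormalCDF.tendsto 0
    have h1 : d₁ S K = fun v => v / 2 := by ext v; simp [d₁, hL]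
    have h2 : d₂ S K = fun v => -(v / 2) := by ext v; simp [d₂, hL]
    have := hlim (l := stdNormalCDF 0) (by rw [h1]; exact c0.comp hh)
      (by rw [h2]; exact c0.comp hn)
    rw [h] at this ⊢
    simpa using this
  · have hL : 0 < -Real.log (K / S) :=
      neg_pos.2 (Real.log_neg (div_pos hK hS) ((div_lt_one hS).2 h))
    have hb := tendsto_div_nhdsGT_zero_atTop hL
    have := hlim (tendsto_stdNormalCDF_atTop.comp (hb.atTop_add hh))
      (tendsto_stdNormalCDF_atTop.comp (hb.atTop_add hn))
    rw [max_eq_left (by linarith)]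
    simpa using this

lemma tendsto_blackScholes_atTop {S K : ℝ} : Tendsto (blackScholes S K) atTop (𝓝 S) := by
  have hi : Tendsto (fun v : ℝ => -Real.log (K / S) / v) atTop (𝓝 0) :=
    tendsto_const_nhds.div_atTop tendsto_id
  have hh : Tendsto (fun v : ℝ => v / 2) atTop atTop := tendsto_id.atTop_div_const two_pos
  have h1 := tendsto_stdNormalCDF_atTop.comp (hi.add_atTop hh)
  have h2 := tendsto_stdNormalCDF_atBot.comp (hi.add_atBot (tendsto_neg_atTop_atBot.comp hh))
  have h := (h1.const_mul S).sub (h2.const_mul K)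
  rw [mul_one, mul_zero, sub_zero] at h
  refine h.congr' ?_
  filter_upwards [eventually_ne_atTop 0] with v hv using (blackScholes_of_ne hv).symm

lemma continuousOn_blackScholes {S K : ℝ} (hS : 0 < S) (hK : 0 < K) :
    ContinuousOn (blackScholes S K) (Ici 0) := by
  intro v hv
  rcases (mem_Ici.1 hv).eq_or_lt with rfl | hv'
  · rw [← continuousWithinAt_Ioi_iff_Ici]
    have := tendsto_blackScholes_nhdsGT_zero hS hK
    rwa [← blackScholes_zero] at this
  · exact (hasDerivAt_blackScholes hS hK hv'.ne').continuousAt.continuousWithinAt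

lemma strictMonoOn_blackScholes {S K : ℝ} (hS : 0 < S) (hK : 0 < K) :
    StrictMonoOn (blackScholes S K) (Ici 0) := by
  refine strictMonoOn_of_deriv_pos (convex_Ici 0) (continuousOn_blackScholes hS hK) fun v hv => ?_
  rw [interior_Ici, mem_Ioi] at hv
  rw [(hasDerivAt_blackScholes hS hK hv.ne').deriv]
  exact mul_pos hS (stdNormalPDF_pos _)

lemma exists_blackScholes_eq {S K p : ℝ} (hS : 0 < S) (hK : 0 < K) (h1 : max (S - K) 0 ≤ p)
    (h2 : p < S) : ∃ v, 0 ≤ v ∧ blackScholes S K v = p := by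
  obtain ⟨V, hV0, hV⟩ := ((eventually_ge_atTop (0 : ℝ)).and
    (tendsto_blackScholes_atTop.eventually (lt_mem_nhds h2))).exists
  obtain ⟨v, hv, e⟩ := intermediate_value_Icc hV0
    ((continuousOn_blackScholes hS hK).mono Icc_subset_Ici_self)
    ⟨by rwa [blackScholes_zero], hV.le⟩
  exact ⟨v, hv.1, e⟩

lemma existsUnique_blackScholes_eq {S K p : ℝ} (hS : 0 < S) (hK : 0 < K)
    (h1 : max (S - K) 0 ≤ p) (h2 : p < S) : ∃! v, 0 ≤ v ∧ blackScholes S K v = p := by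
  obtain ⟨v, hv, e⟩ := exists_blackScholes_eq hS hK h1 h2
  exact ⟨v, ⟨hv, e⟩, fun w ⟨hw, ew⟩ =>
    (strictMonoOn_blackScholes hS hK).injOn hw hv (ew.trans e.symm)⟩

lemma impliedTotalVol_nonneg {S K p : ℝ} (hS : 0 < S) (hK : 0 < K) (h1 : max (S - K) 0 ≤ p)
    (h2 : p < S) : 0 ≤ impliedTotalVol S K p :=
  Function.invFunOn_mem (s := Ici 0) (exists_blackScholes_eq hS hK h1 h2)

lemma blackScholes_impliedTotalVol {S K p : ℝ} (hS : 0 < S) (hK : 0 < K)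
    (h1 : max (S - K) 0 ≤ p) (h2 : p < S) : blackScholes S K (impliedTotalVol S K p) = p :=
  Function.invFunOn_eq (s := Ici 0) (exists_blackScholes_eq hS hK h1 h2)

lemma impliedTotalVol_pos {S K p : ℝ} (hS : 0 < S) (hK : 0 < K) (h1 : max (S - K) 0 < p)
    (h2 : p < S) : 0 < impliedTotalVol S K p := by
  refine (impliedTotalVol_nonneg hS hK h1.le h2).lt_of_ne' fun h => ?_
  have := blackScholes_impliedTotalVol hS hK h1.le h2
  rw [h, blackScholes_zero] at this
  exact h1.ne this

/-! ### Small strikes -/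

lemma d₁_nonneg {S K v : ℝ} (hv : 0 < v) (hL : Real.log (K / S) ≤ 0) : 0 ≤ d₁ S K v :=
  add_nonneg (div_nonneg (by linarith) hv.le) (by linarith)

lemma sqrt_le_d₁ {S K v : ℝ} (hv : 0 < v) (hL : Real.log (K / S) ≤ 0) :
    √(-2 * Real.log (K / S)) ≤ d₁ S K v := by
  refine (Real.sqrt_le_left (d₁_nonneg hv hL)).2 ?_
  have : d₁ S K v ^ 2 - -2 * Real.log (K / S) = d₂ S K v ^ 2 := by
    unfold d₁ d₂; field_simp; ring
  nlinarith [sq_nonneg (d₂ S K v)]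

/-- From `d₁² - d₂² = -2 log (K / S)`; the condition `K ≤ S` selects the nonnegative root for `d₁`.
-/
lemma eq_neg_d₂_add_sqrt {S K v : ℝ} (hv : 0 < v) (hL : Real.log (K / S) ≤ 0) :
    v = -d₂ S K v + √(d₂ S K v ^ 2 + -2 * Real.log (K / S)) := by
  have h : d₂ S K v ^ 2 + -2 * Real.log (K / S) = d₁ S K v ^ 2 := by
    unfold d₁ d₂; field_simp; ring
  rw [h, Real.sqrt_sq (d₁_nonneg hv hL), d₂_eq_d₁_sub]; ring

lemma tendsto_log_div_nhdsGT_zero {X : ℝ} (hX : 0 < X) :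
    Tendsto (fun M => -2 * Real.log (M / X)) (𝓝[>] 0) atTop := by
  have h : Tendsto (fun M : ℝ => M / X) (𝓝[>] 0) (𝓝[>] 0) := by
    refine tendsto_nhdsWithin_iff.2 ⟨?_, ?_⟩
    · have : Tendsto (fun M : ℝ => M / X) (𝓝 0) (𝓝 (0 / X)) := (continuous_id.div_const X).tendsto 0
      rw [zero_div] at this
      exact this.mono_left nhdsWithin_le_nhds
    · filter_upwards [self_mem_nhdsWithin] with M hM using div_pos hM hX
  exact (Real.tendsto_log_nhdsGT_zero.comp h).const_mul_atBot_of_neg (by norm_num)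

lemma tendsto_of_tendsto_stdNormalCDF {ι : Type*} {l : Filter ι} {f : ι → ℝ} {δ : ℝ}
    (h : Tendsto (fun i => stdNormalCDF (f i)) l (𝓝 (stdNormalCDF δ))) : Tendsto f l (𝓝 δ) := by
  refine tendsto_order.2 ⟨fun a ha => ?_, fun a ha => ?_⟩
  · filter_upwards [h.eventually (lt_mem_nhds (strictMono_stdNormalCDF ha))] with i hi
      using strictMono_stdNormalCDF.lt_iff_lt.1 hi
  · filter_upwards [h.eventually (gt_mem_nhds (strictMono_stdNormalCDF ha))] with i hi
      using strictMono_stdNormalCDF.lt_iff_lt.1 hi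

lemma exists_stdNormalCDF_eq {q : ℝ} (h0 : 0 < q) (h1 : q < 1) : ∃ δ, stdNormalCDF δ = q := by
  obtain ⟨a, ha⟩ := (tendsto_stdNormalCDF_atBot.eventually (gt_mem_nhds h0)).exists
  obtain ⟨b, hb⟩ := (tendsto_stdNormalCDF_atTop.eventually (lt_mem_nhds h1)).exists
  exact mem_range_of_exists_le_of_exists_ge continuous_stdNormalCDF ⟨a, ha.le⟩ ⟨b, hb.le⟩

/-- Prices with slope `-q` at the zero strike, `0 < q < 1`, have an implied `d₂` tending to the
`q`-quantile of the normal law. -/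
lemma tendsto_d₂_of_tendsto_slope {X δ : ℝ} (hX : 0 < X) {p v : ℝ → ℝ}
    (hv : ∀ᶠ M in 𝓝[>] 0, 0 < v M) (hp : ∀ᶠ M in 𝓝[>] 0, blackScholes X M (v M) = p M)
    (hq : Tendsto (fun M => (X - p M) / M) (𝓝[>] 0) (𝓝 (stdNormalCDF δ))) :
    Tendsto (fun M => d₂ X M (v M)) (𝓝[>] 0) (𝓝 δ) := by
  have hL := Real.tendsto_sqrt_atTop.comp (tendsto_log_div_nhdsGT_zero hX)
  -- By Mills and `X φ(d₁) = M φ(d₂)`, this is at most `φ(d₂) / d₁ ≤ 1 / d₁`, and `d₁` dominates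
  -- `√(-2 log (M / X))`.
  have hr : Tendsto (fun M => X / M * (1 - stdNormalCDF (d₁ X M (v M)))) (𝓝[>] 0) (𝓝 0) := by
    refine tendsto_of_tendsto_of_tendsto_of_le_of_le' tendsto_const_nhds
      (tendsto_inv_atTop_zero.comp hL) ?_ ?_
    · filter_upwards [self_mem_nhdsWithin] with M hM
      exact mul_nonneg (div_pos hX hM).le (sub_nonneg.2 (stdNormalCDF_le_one _))
    · filter_upwards [self_mem_nhdsWithin, hv, hL.eventually_gt_atTop 0,
        (tendsto_log_div_nhdsGT_zero hX).eventually_gt_atTop 0] with M (hM : 0 < M) hvM h0 hlog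
      simp only [Function.comp_apply] at h0 ⊢
      have hle := sqrt_le_d₁ (S := X) (K := M) hvM (by linarith)
      refine le_trans ?_ (inv_anti₀ h0 hle)
      have hd : 0 < d₁ X M (v M) := h0.trans_le hle
      rw [← one_div, le_div_iff₀ hd]
      have hm := mul_le_mul_of_nonneg_left (mul_one_sub_stdNormalCDF_le hd) (div_pos hX hM).le
      have e : X / M * stdNormalPDF (d₁ X M (v M)) = stdNormalPDF (d₂ X M (v M)) := by
        rw [div_mul_eq_mul_div, mul_stdNormalPDF_d₁ hX hM hvM.ne']; field_simp
      rw [e] at hm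
      nlinarith [stdNormalPDF_le_one (d₂ X M (v M))]
  refine tendsto_of_tendsto_stdNormalCDF ?_
  have h := hq.sub hr
  rw [sub_zero] at h
  refine h.congr' ?_
  filter_upwards [self_mem_nhdsWithin, hv, hp] with M (hM : 0 < M) hvM hpM
  rw [← hpM, blackScholes_of_ne hvM.ne']
  field_simp; ring

lemma tendsto_vol_sub_of_tendsto_d₂ {X δ : ℝ} (hX : 0 < X) {v : ℝ → ℝ}
    (hv : ∀ᶠ M in 𝓝[>] 0, 0 < v M) (hd : Tendsto (fun M => d₂ X M (v M)) (𝓝[>] 0) (𝓝 δ)) :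
    Tendsto (fun M => v M - (√(-2 * Real.log (M / X)) - δ)) (𝓝[>] 0) (𝓝 0) := by
  have hL := tendsto_log_div_nhdsGT_zero hX
  have hs := Real.tendsto_sqrt_atTop.comp hL
  -- With `L = -2 log (M / X)`, the difference `√(d₂² + L) - √L` is at most `d₂² / √L`, and `d₂`
  -- stays bounded.
  have hr : Tendsto (fun M => √(d₂ X M (v M) ^ 2 + -2 * Real.log (M / X))
      - √(-2 * Real.log (M / X))) (𝓝[>] 0) (𝓝 0) := by
    refine tendsto_of_tendsto_of_tendsto_of_le_of_le' tendsto_const_nhds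
      ((hd.pow 2).div_atTop hs) ?_ ?_
    · refine Eventually.of_forall fun M => sub_nonneg.2 (Real.sqrt_le_sqrt ?_)
      linarith [sq_nonneg (d₂ X M (v M))]
    · filter_upwards [hL.eventually_gt_atTop 0] with M hM
      have hpos := Real.sqrt_pos.2 hM
      simp only [Function.comp_apply]
      rw [le_div_iff₀ hpos]
      have h1 := Real.sq_sqrt hM.le
      have h2 := Real.sq_sqrt (add_nonneg (sq_nonneg (d₂ X M (v M))) hM.le)
      have h3 : √(-2 * Real.log (M / X)) ≤ √(d₂ X M (v M) ^ 2 + -2 * Real.log (M / X)) :=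
        Real.sqrt_le_sqrt (by linarith [sq_nonneg (d₂ X M (v M))])
      nlinarith
  have h := hr.sub (hd.sub_const δ)
  rw [sub_self, sub_zero] at h
  refine h.congr' ?_
  filter_upwards [hv, hL.eventually_gt_atTop 0] with M hvM hM
  have := eq_neg_d₂_add_sqrt (S := X) (K := M) hvM (by linarith)
  linarith

/-! ### Large strikes -/

/-- Let `u` and `w` be the implied total volatilities of the same prices `p`, for an underlier `X`
and strikes `M`, and for a larger underlier `S` and strikes `K + M`. Then `u ~ w` for large `M`. -/
lemma isEquivalent_vol_atTop {S K X : ℝ} (hX : 0 < X) (hXS : X < S) (hK : 0 ≤ K) {p u w : ℝ → ℝ}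
    {θ : ℝ} (hθ : θ < 1) (hp : ∀ᶠ M in atTop, p M ≤ θ * X)
    (hu : ∀ M > 0, 0 ≤ u M) (hw : ∀ M > 0, 0 ≤ w M)
    (hpu : ∀ M > 0, blackScholes X M (u M) = p M)
    (hpw : ∀ M > 0, blackScholes S (K + M) (w M) = p M) : u ~[atTop] w := by
  have hS : 0 < S := hX.trans hXS
  have hle : ∀ᶠ M in atTop, w M ≤ u M := by
    -- This is `(K + M) / S ≤ M / X` with denominators cleared.
    have hev : ∀ᶠ M : ℝ in atTop, K * X ≤ (S - X) * M :=
      (tendsto_id.const_mul_atTop (sub_pos.2 hXS)).eventually_ge_atTop _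
    filter_upwards [eventually_gt_atTop 0, hev] with M hM hMK
    by_contra! hlt
    have hw0 : 0 < w M := (hu M hM).trans_lt hlt
    have hKM : 0 < K + M := by linarith
    have h1 := strictMonoOn_blackScholes hX hM (hu M hM) hw0.le hlt
    rw [hpu M hM, ← hpw M hM, blackScholes_eq_mul_normalizedBS hX hM hw0.ne',
      blackScholes_eq_mul_normalizedBS hS hKM hw0.ne'] at h1
    have h2 : d₁ X M (w M) ≤ d₁ S (K + M) (w M) := by
      have : Real.log ((K + M) / S) ≤ Real.log (M / X) := by
        refine Real.log_le_log (div_pos hKM hS) ?_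
        rw [div_le_div_iff₀ hS hX]; linarith
      unfold d₁
      gcongr
    have h3 := normalizedBS_mono_right hw0.le h2
    have h4 := mul_le_mul hXS.le h3 (normalizedBS_nonneg hw0.le _) hS.le
    linarith
  have hub : ∀ r > 1, ∀ᶠ M in atTop, u M ≤ r * w M := by
    intro r hr
    have ha : 0 ≤ Real.log (S / X) := Real.log_nonneg ((one_le_div hX).2 hXS.le)
    have hk : Tendsto (fun M => Real.log ((K + M) / S)) atTop atTop :=
      Real.tendsto_log_atTop.comp
        ((tendsto_atTop_add_const_left _ K tendsto_id).atTop_div_const hS)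
    filter_upwards [eventually_gt_atTop 0, eventually_gt_atTop S, hp,
      hk.eventually (eventually_exp_mul_normalizedBS_le ha hr hθ)] with M hM hMS hpM hMk
    have hKM : 0 < K + M := by linarith
    -- Zero volatility is not excluded: past the strike `S` it means a zero price, which forces `u M
    -- = 0` too.
    rcases (hw M hM).eq_or_lt with h0 | hw0
    · have h1 : blackScholes X M (u M) = blackScholes X M 0 := by
        rw [blackScholes_zero, max_eq_right (by linarith), hpu M hM, ← hpw M hM, ← h0,
          blackScholes_zero, max_eq_right (by linarith)]
      rw [(strictMonoOn_blackScholes hX hM).injOn (hu M hM) self_mem_Ici h1, ← h0, mul_zero]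
    · have hrw : 0 < r * w M := mul_pos (by linarith) hw0
      have hb : Real.exp (Real.log (S / X)) * normalizedBS (w M) (d₁ S (K + M) (w M)) = p M / X := by
        rw [Real.exp_log (div_pos hS hX), ← hpw M hM,
          blackScholes_eq_mul_normalizedBS hS hKM hw0.ne']
        field_simp
      have h1 := hMk (w M) hw0 (by
        change Real.exp (Real.log (S / X)) * normalizedBS (w M) (d₁ S (K + M) (w M)) ≤ θ
        rwa [hb, div_le_iff₀ hX])
      change Real.exp (Real.log (S / X)) * normalizedBS (w M) (d₁ S (K + M) (w M)) ≤ _ at h1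
      rw [hb, div_le_iff₀' hX] at h1
      have h2 : -(Real.log ((K + M) / S) + Real.log (S / X)) / (r * w M) + r * w M / 2
          ≤ d₁ X M (r * w M) := by
        have : Real.log (M / X) ≤ Real.log ((K + M) / S) + Real.log (S / X) := by
          rw [← Real.log_mul (div_pos hKM hS).ne' (div_pos hS hX).ne']
          refine Real.log_le_log (div_pos hM hX) ?_
          rw [div_mul_div_cancel₀ hS.ne']
          gcongr; linarith
        unfold d₁
        gcongr
      have h3 : p M ≤ blackScholes X M (r * w M) := by
        rw [blackScholes_eq_mul_normalizedBS hX hM hrw.ne']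
        exact h1.trans (mul_le_mul_of_nonneg_left (normalizedBS_mono_right hrw.le h2) hX.le)
      rw [← hpu M hM] at h3
      exact (strictMonoOn_blackScholes hX hM).le_iff_le (hu M hM) hrw.le |>.1 h3
  refine isLittleO_iff.2 fun c hc => ?_
  filter_upwards [eventually_gt_atTop 0, hle, hub (1 + c) (by linarith)] with M hM h1 h2
  rw [Pi.sub_apply, Real.norm_of_nonneg (sub_nonneg.2 h1), Real.norm_of_nonneg (hw M hM)]
  linarith

/-! ### Call pricing functions -/

namespace IsCallPricingFunction

variable {C : ℝ → ℝ → ℝ} {S K : ℝ}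

lemma apply_zero (hC : IsCallPricingFunction C) (hS : 0 < S) : C S 0 = S := by
  refine le_antisymm (hC.upper S 0 hS le_rfl) ?_
  have := hC.lower S 0 hS le_rfl
  rw [sub_zero, max_eq_left hS.le] at this
  exact this

/-- A positive slope `m` would persist by convexity, and over a further length `(S + 1) / m` would
push the price above its bound `S`. -/
lemma antitoneOn (hC : IsCallPricingFunction C) (hS : 0 < S) : AntitoneOn (C S) (Ici 0) := by
  intro x hx y hy hxy
  rw [mem_Ici] at hx hy
  by_contra! hlt
  have hxy' : x < y := hxy.lt_of_ne fun h => by rw [h] at hlt; exact hlt.false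
  set m := (C S y - C S x) / (y - x) with hm
  have hm0 : 0 < m := div_pos (by linarith) (by linarith)
  have hz : y < y + (S + 1) / m := by
    have : 0 < (S + 1) / m := by positivity
    linarith
  have h := (hC.convex S hS).slope_mono_adjacent (mem_Ici.2 hx)
    (mem_Ici.2 (hy.trans hz.le)) hxy' hz
  rw [← hm, add_sub_cancel_left, le_div_iff₀ (by positivity), mul_div_cancel₀ _ hm0.ne'] at h
  have h1 := hC.upper S _ hS (hy.trans hz.le)
  have h2 := (le_max_right _ _).trans (hC.lower S y hS hy)
  linarith

/-- Past the strike `K`, prices decrease at most at the average rate observed on `[0, K]`. -/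
lemma sub_mul_le (hC : IsCallPricingFunction C) (hS : 0 < S) (hK : 0 < K) {M : ℝ} (hM : 0 < M) :
    C S K - (S - C S K) / K * M ≤ C S (K + M) := by
  have h := (hC.convex S hS).slope_mono_adjacent (x := 0) (y := K) (z := K + M)
    self_mem_Ici (mem_Ici.2 (by linarith)) hK (by linarith)
  rw [hC.apply_zero hS, sub_zero, add_sub_cancel_left, le_div_iff₀ hM] at h
  have : (C S K - S) / K * M = -((S - C S K) / K * M) := by ring
  linarith

/-- The decrements of the price from the strike `K` have a limit slope at `0`, in `(0, 1)`. -/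
lemma exists_tendsto_slope (hC : IsCallPricingFunction C) (hS : 0 < S) (hK : 0 < K)
    (htime : S - K < C S K) (hlt : ∀ M, 0 < M → C S (K + M) < C S K) :
    ∃ q, 0 < q ∧ q < 1 ∧ Tendsto (fun M => (C S K - C S (K + M)) / M) (𝓝[>] 0) (𝓝 q) := by
  set g : ℝ → ℝ := fun M => (C S (K + M) - C S K) / M with hg
  have hmono : MonotoneOn g (Ioi 0) := by
    intro x (hx : 0 < x) y (hy : 0 < y) hxy
    have := (hC.convex S hS).secant_mono (a := K) (x := K + x) (y := K + y) (mem_Ici.2 hK.le)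
      (mem_Ici.2 (by linarith)) (mem_Ici.2 (by linarith)) (by linarith) (by linarith)
      (by linarith)
    simpa [hg] using this
  have hlow : ∀ M ∈ Ioi (0 : ℝ), -((S - C S K) / K) ≤ g M := by
    intro M (hM : 0 < M)
    rw [hg, le_div_iff₀ hM]
    linarith [hC.sub_mul_le hS hK hM]
  have hbdd : BddBelow (g '' Ioi 0) := ⟨_, forall_mem_image.2 hlow⟩
  have hlim := hmono.tendsto_nhdsGT hbdd
  refine ⟨-sInf (g '' Ioi 0), ?_, ?_, ?_⟩
  · have h1 : sInf (g '' Ioi 0) ≤ g 1 := csInf_le hbdd (mem_image_of_mem g (mem_Ioi.2 one_pos))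
    have h2 : g 1 < 0 := by
      have := hlt 1 one_pos
      simp only [hg, div_one]; linarith
    linarith
  -- The chord over `[0, K]` bounds the slope, and time value at `K` makes its steepness less than
  -- `1`.
  · have h1 : -((S - C S K) / K) ≤ sInf (g '' Ioi 0) :=
      le_csInf (nonempty_Ioi.image g) (forall_mem_image.2 hlow)
    have h2 : (S - C S K) / K < 1 := by rw [div_lt_one hK]; linarith
    linarith
  · refine hlim.neg.congr fun M => ?_
    simp only [hg]; ring

end IsCallPricingFunction

/-! ### Assembly for the Call on Call. -/

theorem mainTheorem11 (C : ℝ → ℝ → ℝ) (hC : IsCallPricingFunction C) (K X : ℝ) (hK : 0 < K)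
    (hinv : InjOn (fun S => C S K) (Ioi 0)) (hX : X ∈ (fun S => C S K) '' Ioi 0)
    (htime : max (callInv C X K - K) 0 < X)
    (hlt : ∀ M, 0 < M → callOnCall C K X M < X) :
    -- the implied total volatilities are well defined
    (∀ M, 0 < M → ∃! v, 0 ≤ v ∧ blackScholes X M v = callOnCall C K X M) ∧
    (∀ M, 0 < M → ∃! v, 0 ≤ v ∧
      blackScholes (callInv C X K) (K + M) v = C (callInv C X K) (K + M)) ∧
    -- small strikes; `δ` is the finite limit `d̂₂(X, 0)`
    (∃ δ : ℝ, Tendsto (fun M => callOnCallD₂ C K X M) (𝓝[>] 0) (𝓝 δ) ∧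
      (fun M => callOnCallVol C K X M) ~[𝓝[>] 0]
        (fun M => Real.sqrt (-2 * Real.log (M / X)) - δ) ∧
      Tendsto (fun M => callOnCallVol C K X M - (Real.sqrt (-2 * Real.log (M / X)) - δ))
        (𝓝[>] 0) (𝓝 0)) ∧
    -- large strikes
    (fun M => callOnCallVol C K X M) ~[atTop]
      (fun M => underlyingVol C (callInv C X K) (K + M)) ∧
    (∀ l : ℝ, Tendsto (fun M => callOnCallVol C K X M) atTop (𝓝 l) ↔
      Tendsto (fun M => underlyingVol C (callInv C X K) (K + M)) atTop (𝓝 l)) ∧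
    (Tendsto (fun M => callOnCallVol C K X M) atTop atTop ↔
      Tendsto (fun M => underlyingVol C (callInv C X K) (K + M)) atTop atTop) := by
  have hS : 0 < callInv C X K := Function.invFunOn_mem (s := Ioi 0) hX
  have hCX : C (callInv C X K) K = X := Function.invFunOn_eq (s := Ioi 0) hX
  simp only [callOnCallD₂, callOnCallVol, callOnCall, underlyingVol] at hlt ⊢
  set S := callInv C X K with hSdef
  have hX0 : 0 < X := (le_max_right _ _).trans_lt htime
  have hSK : S - K < X := (le_max_left _ _).trans_lt htime
  have hlt' : ∀ M, 0 < M → C S (K + M) < C S K := by rwa [hCX]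
  -- The slope over `[0, K]` is at most that over `[K, K + 1]`, which is negative.
  have hXS : X < S := by
    have h := (hC.convex S hS).slope_mono_adjacent (x := 0) (y := K) (z := K + 1)
      self_mem_Ici (mem_Ici.2 (by linarith)) hK (by linarith)
    have h1 := hlt 1 one_pos
    rw [hC.apply_zero hS, hCX, add_sub_cancel_left, div_one, sub_zero, div_le_iff₀ hK] at h
    nlinarith
  have hrate : (S - X) / K < 1 := by rw [div_lt_one hK]; linarith
  -- Prices fall beyond `K` at rate less than `1`; strictness yields positive implied volatilities
  -- for small `M`.
  have hlowX : ∀ M, 0 < M → X - M < C S (K + M) := by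
    intro M hM
    have := hC.sub_mul_le hS hK hM
    rw [hCX] at this
    nlinarith
  have hnn : ∀ M, 0 < M → 0 ≤ C S (K + M) := fun M hM =>
    (le_max_right _ _).trans (hC.lower S (K + M) hS (by linarith))
  have hlowX' : ∀ M, 0 < M → max (X - M) 0 ≤ C S (K + M) := fun M hM =>
    max_le (hlowX M hM).le (hnn M hM)
  have hlowS : ∀ M, 0 < M → max (S - (K + M)) 0 ≤ C S (K + M) := fun M hM =>
    hC.lower S (K + M) hS (by linarith)
  have hltS : ∀ M, 0 < M → C S (K + M) < S := fun M hM => (hlt M hM).trans hXS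
  have hequiv : (fun M => impliedTotalVol X M (C S (K + M))) ~[atTop]
      (fun M => impliedTotalVol S (K + M) (C S (K + M))) := by
    -- Prices are non-increasing in the strike, so the value at `M = 1` keeps `p / X` away from `1`
    -- for all `M ≥ 1`.
    refine isEquivalent_vol_atTop (p := fun M => C S (K + M)) (θ := C S (K + 1) / X) hX0 hXS hK.le
      ((div_lt_one hX0).2 (hlt 1 one_pos)) ?_
      (fun M hM => impliedTotalVol_nonneg hX0 hM (hlowX' M hM) (hlt M hM))
      (fun M hM => impliedTotalVol_nonneg hS (by linarith) (hlowS M hM) (hltS M hM))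
      (fun M hM => blackScholes_impliedTotalVol hX0 hM (hlowX' M hM) (hlt M hM))
      (fun M hM => blackScholes_impliedTotalVol hS (by linarith) (hlowS M hM) (hltS M hM))
    filter_upwards [eventually_ge_atTop 1] with M hM
    rw [div_mul_cancel₀ _ hX0.ne']
    exact hC.antitoneOn hS (mem_Ici.2 (by linarith)) (mem_Ici.2 (by linarith)) (by linarith)
  refine ⟨fun M hM => existsUnique_blackScholes_eq hX0 hM (hlowX' M hM) (hlt M hM),
    fun M hM => existsUnique_blackScholes_eq hS (by linarith) (hlowS M hM) (hltS M hM), ?_,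
    hequiv, fun l => hequiv.tendsto_nhds_iff, hequiv.tendsto_atTop_iff⟩
  obtain ⟨q, hq0, hq1, hq⟩ := hC.exists_tendsto_slope hS hK (by rwa [hCX]) hlt'
  obtain ⟨δ, rfl⟩ := exists_stdNormalCDF_eq hq0 hq1
  rw [hCX] at hq
  have hvpos : ∀ᶠ M in 𝓝[>] 0, 0 < impliedTotalVol X M (C S (K + M)) := by
    filter_upwards [Ioo_mem_nhdsGT hX0] with M hM
    refine impliedTotalVol_pos hX0 hM.1 (max_lt (hlowX M hM.1) ?_) (hlt M hM.1)
    linarith [hlowX M hM.1, hM.2]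
  have hd := tendsto_d₂_of_tendsto_slope hX0 hvpos (by
    filter_upwards [self_mem_nhdsWithin] with M (hM : 0 < M)
    exact blackScholes_impliedTotalVol hX0 hM (hlowX' M hM) (hlt M hM)) hq
  have hdiff := tendsto_vol_sub_of_tendsto_d₂ hX0 hvpos hd
  refine ⟨δ, hd, ?_, hdiff⟩
  have htop : Tendsto (fun M => √(-2 * Real.log (M / X)) - δ) (𝓝[>] 0) atTop :=
    tendsto_atTop_add_const_right _ (-δ)
      (Real.tendsto_sqrt_atTop.comp (tendsto_log_div_nhdsGT_zero hX0))
  -- An `o(1)` error is negligible against a comparison function tending to infinity.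
  exact ((isLittleO_one_iff ℝ).2 hdiff).trans
    (isLittleO_const_left.2 (Or.inr (tendsto_norm_atTop_atTop.comp htop)))
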